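/- For real $q>1$ and $k\in\{0,1,2,\dots\}$ write $(q^{-2};q^{-2})_k=\prod_{j=1}^{k}(1-q^{-2j})$, and let $N=N_q$ be a random variable with the $q$-Poisson (Euler) law $$\mathbb P\{N=k\}=\frac{1}{e_{q^{-2}}(1/q)}\,\frac{q^{-k}}{(q^{-2};q^{-2})_k},\quad k=0,1,2,\dots,\qquad\text{where } e_{q^{-2}}(z)=\sum_{k=0}^{\infty}\frac{z^k}{(q^{-2};q^{-2})_k}\quad(|z|<1).$$ As $q\downarrow 1$, the distribution of the random variable $2(\log q)N+\log(q-1)$ converges weakly to the probability distribution on $\mathbb R$ with density $$x\mapsto\frac{1}{\sqrt{2\pi}}\exp\left(-\frac12\left(x+e^{-x}\right)\right),\qquad -\infty<x<\infty.$$ -/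

import Mathlib

open MeasureTheory ProbabilityTheory Filter Topology

noncomputable section

namespace QPoisson

/-- The finite `q`-Pochhammer symbol `(z; r)_n = ∏_{k < n} (1 - z r ^ k)`. -/
def qPochhammer (z r : ℝ) (n : ℕ) : ℝ := ∏ k ∈ Finset.range n, (1 - z * r ^ k)

/-- The `q`-exponential function `e_r(z) = ∑_{k ≥ 0} z ^ k / (r; r)_k`, for `0 < r < 1`, `|z| < 1`. -/
def qExp (r z : ℝ) : ℝ := ∑' k : ℕ, z ^ k / qPochhammer r r k

theorem qPochhammer_pos {r : ℝ} (h0 : 0 < r) (h1 : r < 1) (n : ℕ) : 0 < qPochhammer r r n := by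
  refine Finset.prod_pos fun k _ => ?_
  have : r * r ^ k < 1 := by
    rw [← pow_succ']
    exact pow_lt_one₀ h0.le h1 (Nat.succ_ne_zero k)
  linarith

theorem summable_qExp {r z : ℝ} (h0 : 0 < r) (h1 : r < 1) (hz0 : 0 < z) (hz1 : z < 1) :
    Summable fun k : ℕ => z ^ k / qPochhammer r r k := by
  have hpos : ∀ k : ℕ, 0 < z ^ k / qPochhammer r r k := fun k =>
    div_pos (pow_pos hz0 k) (qPochhammer_pos h0 h1 k)
  refine summable_of_ratio_test_tendsto_lt_one (l := z) hz1
    (Eventually.of_forall fun k => (hpos k).ne') ?_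
  have heq : (fun k : ℕ => ‖z ^ (k + 1) / qPochhammer r r (k + 1)‖ / ‖z ^ k / qPochhammer r r k‖)
      = fun k : ℕ => z / (1 - r * r ^ k) := by
    funext k
    rw [Real.norm_of_nonneg (hpos _).le, Real.norm_of_nonneg (hpos _).le]
    have hk := (qPochhammer_pos h0 h1 k).ne'
    have hk1 := (qPochhammer_pos h0 h1 (k + 1)).ne'
    have hs : qPochhammer r r (k + 1) = qPochhammer r r k * (1 - r * r ^ k) :=
      Finset.prod_range_succ _ _
    rw [hs] at hk1 ⊢
    have hk2 := right_ne_zero_of_mul hk1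
    have hz := hz0.ne'
    field_simp
    rw [pow_succ]
  rw [heq]
  have hlim : Tendsto (fun k : ℕ => z / (1 - r * r ^ k)) atTop (𝓝 (z / (1 - r * 0))) :=
    tendsto_const_nhds.div
      (tendsto_const_nhds.sub
        (tendsto_const_nhds.mul (tendsto_pow_atTop_nhds_zero_of_lt_one h0.le h1))) (by simp)
  simpa using hlim

/-- The Euler (`q`-Poisson) law on `ℕ` with parameter `q > 1`:
the mass at `k` is `e_{q⁻²}(q⁻¹)⁻¹ * q⁻ᵏ / (q⁻²; q⁻²)_k`. -/
def eulerPMF (q : Set.Ioi (1 : ℝ)) : PMF ℕ :=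
  ⟨fun k => ENNReal.ofReal ((qExp ((q : ℝ) ^ (-2 : ℤ)) (q : ℝ)⁻¹)⁻¹ *
      ((q : ℝ) ^ (-(k : ℤ)) / qPochhammer ((q : ℝ) ^ (-2 : ℤ)) ((q : ℝ) ^ (-2 : ℤ)) k)), by
    obtain ⟨q, hq⟩ := q
    have hq1 : (1 : ℝ) < q := hq
    have hq0 : (0 : ℝ) < q := one_pos.trans hq1
    have h0 : (0 : ℝ) < q ^ (-2 : ℤ) := zpow_pos hq0 _
    have h1 : q ^ (-2 : ℤ) < (1 : ℝ) := zpow_lt_one_of_neg₀ hq1 (by norm_num)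
    have hz0 : (0 : ℝ) < q⁻¹ := inv_pos.2 hq0
    have hz1 : q⁻¹ < (1 : ℝ) := inv_lt_one_of_one_lt₀ hq1
    have hpos : ∀ k : ℕ, 0 < q⁻¹ ^ k / qPochhammer (q ^ (-2 : ℤ)) (q ^ (-2 : ℤ)) k := fun k =>
      div_pos (pow_pos hz0 k) (qPochhammer_pos h0 h1 k)
    have hsum := summable_qExp h0 h1 hz0 hz1
    have hE : 0 < qExp (q ^ (-2 : ℤ)) q⁻¹ := hsum.tsum_pos (fun k => (hpos k).le) 0 (hpos 0)
    have hs : HasSum (fun k : ℕ => (qExp (q ^ (-2 : ℤ)) q⁻¹)⁻¹ *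
        (q ^ (-(k : ℤ)) / qPochhammer (q ^ (-2 : ℤ)) (q ^ (-2 : ℤ)) k)) 1 := by
      have h := hsum.hasSum.mul_left (qExp (q ^ (-2 : ℤ)) q⁻¹)⁻¹
      have h2 : (qExp (q ^ (-2 : ℤ)) q⁻¹)⁻¹ *
          (∑' k : ℕ, q⁻¹ ^ k / qPochhammer (q ^ (-2 : ℤ)) (q ^ (-2 : ℤ)) k) = 1 :=
        inv_mul_cancel₀ hE.ne'
      rw [h2] at h
      simpa only [zpow_neg, zpow_natCast, inv_pow] using h
    have hnn : ∀ k : ℕ, 0 ≤ (qExp (q ^ (-2 : ℤ)) q⁻¹)⁻¹ *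
        (q ^ (-(k : ℤ)) / qPochhammer (q ^ (-2 : ℤ)) (q ^ (-2 : ℤ)) k) := fun k =>
      mul_nonneg (inv_pos.2 hE).le
        (div_pos (zpow_pos hq0 _) (qPochhammer_pos h0 h1 k)).le
    have h3 := ENNReal.ofReal_tsum_of_nonneg hnn hs.summable
    rw [hs.tsum_eq, ENNReal.ofReal_one] at h3
    rw [h3]
    exact ENNReal.summable.hasSum⟩

/-- The measure on the real line with density `(2π)^{-1/2} exp(-(x + e^{-x}) / 2)`
with respect to Lebesgue measure. -/
def limitLaw : Measure ℝ :=
  volume.withDensity fun x =>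
    ENNReal.ofReal (1 / Real.sqrt (2 * Real.pi) * Real.exp (-(1 / 2) * (x + Real.exp (-x))))

end QPoisson

end

noncomputable section

namespace QPoisson

/-! Put r = q⁻² and x_k = 2k log q + log(q - 1). Up to a factor free of k, the Euler mass at k is
e^{-x_k/2} ∏_{j>k} (1 - r^j) (`eulerMass_eq`). The product is close to exp(-∑_{j>k} r^j) =
exp(-e^{-x_k}/(q + 1)) by `tailProd_le`, `le_tailProd` and `zpow_div_eq`, so the weight tends to
e^{-x/2} exp(-e^{-x}/2) as x_k → x.

Expectations are thus ratios of Riemann sums of mesh 2 log q, written as integrals of step functions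
(`integral_eulerPMF`), and dominated convergence applies (`stepFun_abs_le`). The denominator is the
case f = 1, so no separate asymptotics of the q-exponential are needed. The substitution u =
e^{-x/2} turns the limiting denominator into a Gaussian integral. -/

/-! ### Two-sided bounds for tails of the infinite product -/

theorem qPochhammer_succ (r : ℝ) (n : ℕ) :
    qPochhammer r r (n + 1) = qPochhammer r r n * (1 - r ^ (n + 1)) := by
  rw [pow_succ']
  exact Finset.prod_range_succ _ _

theorem antitone_qPochhammer {r : ℝ} (h0 : 0 < r) (h1 : r < 1) :
    Antitone (qPochhammer r r) := by
  refine antitone_nat_of_succ_le fun n => ?_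
  rw [qPochhammer_succ]
  exact mul_le_of_le_one_right (qPochhammer_pos h0 h1 n).le (by linarith [pow_pos h0 (n + 1)])

/-- The infinite `q`-Pochhammer symbol `(r; r)_∞`. -/
def qPochhammerInf (r : ℝ) : ℝ := ⨅ n, qPochhammer r r n

theorem tendsto_qPochhammer {r : ℝ} (h0 : 0 < r) (h1 : r < 1) :
    Tendsto (qPochhammer r r) atTop (𝓝 (qPochhammerInf r)) :=
  tendsto_atTop_ciInf (antitone_qPochhammer h0 h1)
    ⟨0, by rintro _ ⟨n, rfl⟩; exact (qPochhammer_pos h0 h1 n).le⟩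

/-- The tail product `∏_{j > k} (1 - r ^ j)`. -/
def tailProd (r : ℝ) (k : ℕ) : ℝ := qPochhammerInf r / qPochhammer r r k

theorem tendsto_tailProd {r : ℝ} (h0 : 0 < r) (h1 : r < 1) (k : ℕ) :
    Tendsto (fun n => qPochhammer r r (k + n) / qPochhammer r r k) atTop (𝓝 (tailProd r k)) := by
  have h := (tendsto_qPochhammer h0 h1).div_const (qPochhammer r r k)
  exact h.comp (tendsto_atTop_mono (fun n => Nat.le_add_left n k) tendsto_id)

/-- Apply 1 - u ≤ e^{-u} to each factor and sum the geometric series. -/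
theorem tailProd_le {r : ℝ} (h0 : 0 < r) (h1 : r < 1) (k : ℕ) :
    tailProd r k ≤ Real.exp (-(r ^ (k + 1) / (1 - r))) := by
  have hr : (0 : ℝ) < 1 - r := by linarith
  have key : ∀ n, qPochhammer r r (k + n) / qPochhammer r r k
      ≤ Real.exp (-(r ^ (k + 1) * (1 - r ^ n) / (1 - r))) := by
    intro n
    induction n with
    | zero => simp [(qPochhammer_pos h0 h1 k).ne']
    | succ n ih =>
      rw [← add_assoc, qPochhammer_succ, mul_div_right_comm]
      have hsplit : -(r ^ (k + 1) * (1 - r ^ (n + 1)) / (1 - r))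
          = -(r ^ (k + 1) * (1 - r ^ n) / (1 - r)) + -(r ^ (k + n + 1)) := by
        field_simp
        ring
      rw [hsplit, Real.exp_add]
      refine mul_le_mul ih ?_ ?_ (Real.exp_pos _).le
      · linarith [Real.add_one_le_exp (-(r ^ (k + n + 1)))]
      · linarith [pow_le_one₀ (n := k + n + 1) h0.le h1.le]
  refine le_of_tendsto_of_tendsto' (tendsto_tailProd h0 h1 k) ?_ key
  have hp := tendsto_pow_atTop_nhds_zero_of_lt_one h0.le h1
  have h2 := (((tendsto_const_nhds (x := (1 : ℝ))).sub hp).const_mul (r ^ (k + 1))).div_const (1 - r)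
  rw [sub_zero, mul_one] at h2
  exact (Real.continuous_exp.tendsto _).comp h2.neg

/-- Each factor satisfies 1 - u ≥ e^{-u/(1-u)}, and u ≤ r^(k+1) makes the denominator uniform in j.
The extra 1 - r^(k+1) tends to 1 in the regime of interest. -/
theorem le_tailProd {r : ℝ} (h0 : 0 < r) (h1 : r < 1) (k : ℕ) :
    Real.exp (-(r ^ (k + 1) / (1 - r) / (1 - r ^ (k + 1)))) ≤ tailProd r k := by
  have hr : (0 : ℝ) < 1 - r := by linarith
  have hk : (0 : ℝ) < 1 - r ^ (k + 1) := sub_pos.2 (pow_lt_one₀ h0.le h1 (Nat.succ_ne_zero k))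
  have key : ∀ n, Real.exp (-(r ^ (k + 1) * (1 - r ^ n) / (1 - r) / (1 - r ^ (k + 1))))
      ≤ qPochhammer r r (k + n) / qPochhammer r r k := by
    intro n
    induction n with
    | zero => simp [(qPochhammer_pos h0 h1 k).ne']
    | succ n ih =>
      rw [← add_assoc, qPochhammer_succ,
        mul_div_right_comm (qPochhammer r r (k + n))]
      have hsplit : -(r ^ (k + 1) * (1 - r ^ (n + 1)) / (1 - r) / (1 - r ^ (k + 1)))
          = -(r ^ (k + 1) * (1 - r ^ n) / (1 - r) / (1 - r ^ (k + 1)))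
            + -(r ^ (k + n + 1) / (1 - r ^ (k + 1))) := by
        field_simp
        ring
      rw [hsplit, Real.exp_add]
      have hu : r ^ (k + n + 1) ≤ r ^ (k + 1) := pow_le_pow_of_le_one h0.le h1.le (by omega)
      have hu0 : 0 < 1 - r ^ (k + n + 1) := by linarith
      refine mul_le_mul ih ?_ (Real.exp_pos _).le
        (div_pos (qPochhammer_pos h0 h1 _) (qPochhammer_pos h0 h1 _)).le
      rw [← Real.le_log_iff_exp_le hu0]
      refine le_trans ?_ (Real.one_sub_inv_le_log_of_pos hu0)
      have h3 : 1 - (1 - r ^ (k + n + 1))⁻¹ = -(r ^ (k + n + 1) / (1 - r ^ (k + n + 1))) := by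
        field_simp
        ring
      rw [h3, neg_le_neg_iff]
      exact div_le_div_of_nonneg_left (pow_pos h0 _).le hk (by linarith)
  refine le_of_tendsto_of_tendsto' ?_ (tendsto_tailProd h0 h1 k) key
  have hp := tendsto_pow_atTop_nhds_zero_of_lt_one h0.le h1
  have h2 := ((((tendsto_const_nhds (x := (1 : ℝ))).sub hp).const_mul
    (r ^ (k + 1))).div_const (1 - r)).div_const (1 - r ^ (k + 1))
  rw [sub_zero, mul_one] at h2
  exact (Real.continuous_exp.tendsto _).comp h2.neg

theorem tailProd_pos {r : ℝ} (h0 : 0 < r) (h1 : r < 1) (k : ℕ) : 0 < tailProd r k :=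
  (Real.exp_pos _).trans_le (le_tailProd h0 h1 k)

theorem qPochhammerInf_pos {r : ℝ} (h0 : 0 < r) (h1 : r < 1) : 0 < qPochhammerInf r := by
  have h := tailProd_pos h0 h1 0
  simpa [tailProd, qPochhammer] using h

/-! ### The limit density and its Gaussian normalisation -/

/-- The (unnormalised) limit density with rate `c`. -/
def gumbelDensity (c x : ℝ) : ℝ := Real.exp (-x / 2) * Real.exp (-c * Real.exp (-x))

/-- Exhibits the Jacobian of u = e^{-x/2}, in the shape the change-of-variables theorems require. -/
theorem gumbelDensity_eq (c x : ℝ) : gumbelDensity c x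
    = 2 * (|-(1 / 2) * Real.exp (-x / 2)| • Real.exp (-c * Real.exp (-x / 2) ^ 2)) := by
  have h : Real.exp (-x / 2) ^ 2 = Real.exp (-x) := by
    rw [← Real.exp_nat_mul]
    congr 1
    push_cast
    ring
  rw [h, abs_mul, Real.abs_exp, gumbelDensity, smul_eq_mul]
  norm_num
  ring

theorem hasDerivAt_exp_neg_half (x : ℝ) :
    HasDerivAt (fun x : ℝ => Real.exp (-x / 2)) (-(1 / 2) * Real.exp (-x / 2)) x := by
  have h := (((hasDerivAt_id x).neg).div_const 2).exp
  convert! h using 1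
  simp
  ring

theorem image_exp_neg_half : (fun x : ℝ => Real.exp (-x / 2)) '' Set.univ = Set.Ioi 0 := by
  ext y
  simp only [Set.image_univ, Set.mem_range, Set.mem_Ioi]
  refine ⟨fun ⟨x, hx⟩ => hx ▸ Real.exp_pos _, fun hy => ⟨-2 * Real.log y, ?_⟩⟩
  rw [show -(-2 * Real.log y) / 2 = Real.log y by ring, Real.exp_log hy]

theorem injective_exp_neg_half : Function.Injective fun x : ℝ => Real.exp (-x / 2) := by
  intro x y h
  have := Real.exp_injective h
  linarith

theorem integrable_gumbelDensity {c : ℝ} (hc : 0 < c) : Integrable (gumbelDensity c) := by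
  have h := (integrableOn_image_iff_integrableOn_abs_deriv_smul MeasurableSet.univ
    (fun x _ => (hasDerivAt_exp_neg_half x).hasDerivWithinAt) injective_exp_neg_half.injOn
    (fun u => Real.exp (-c * u ^ 2))).1 (integrable_exp_neg_mul_sq hc).integrableOn
  rw [integrableOn_univ] at h
  rw [funext (gumbelDensity_eq c)]
  exact h.const_mul 2

theorem integral_gumbelDensity (c : ℝ) : ∫ x, gumbelDensity c x = √(Real.pi / c) := by
  have h := integral_image_eq_integral_abs_deriv_smul MeasurableSet.univ
    (fun x _ => (hasDerivAt_exp_neg_half x).hasDerivWithinAt) injective_exp_neg_half.injOn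
    (fun u => Real.exp (-c * u ^ 2))
  rw [image_exp_neg_half, integral_gaussian_Ioi, setIntegral_univ] at h
  rw [funext (gumbelDensity_eq c), integral_const_mul, ← h]
  ring

theorem limitLaw_eq : limitLaw
    = volume.withDensity fun x => ENNReal.ofReal ((√(2 * Real.pi))⁻¹ * gumbelDensity (1 / 2) x) := by
  unfold limitLaw gumbelDensity
  congr 1
  funext x
  rw [← Real.exp_add, one_div]
  congr 3
  ring

theorem integral_gumbelDensity_half : ∫ x, gumbelDensity (1 / 2) x = √(2 * Real.pi) := by
  rw [integral_gumbelDensity]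
  congr 1
  ring

theorem gumbelDensity_nonneg (c x : ℝ) : 0 ≤ gumbelDensity c x := by
  unfold gumbelDensity
  positivity

theorem continuous_gumbelDensity (c : ℝ) : Continuous (gumbelDensity c) := by
  unfold gumbelDensity
  fun_prop

instance isProbabilityMeasure_limitLaw : IsProbabilityMeasure limitLaw := by
  constructor
  rw [limitLaw_eq, withDensity_apply _ MeasurableSet.univ, setLIntegral_univ,
    ← ofReal_integral_eq_lintegral_ofReal
      ((integrable_gumbelDensity (by norm_num)).const_mul _)
      (ae_of_all _ fun x => mul_nonneg (by positivity) (gumbelDensity_nonneg _ _)),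
    integral_const_mul, integral_gumbelDensity_half, inv_mul_cancel₀ (by positivity),
    ENNReal.ofReal_one]

theorem integral_limitLaw (f : ℝ → ℝ) :
    ∫ x, f x ∂limitLaw = (∫ x, f x * gumbelDensity (1 / 2) x) / √(2 * Real.pi) := by
  rw [limitLaw_eq, integral_withDensity_eq_integral_toReal_smul
    (((continuous_gumbelDensity _).measurable.const_mul _).ennreal_ofReal)
    (ae_of_all _ fun x => ENNReal.ofReal_lt_top), div_eq_inv_mul (∫ x, _), ← integral_const_mul]
  refine integral_congr_ae (ae_of_all _ fun x => ?_)
  have h : 0 ≤ (√(2 * Real.pi))⁻¹ * gumbelDensity (1 / 2) x :=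
    mul_nonneg (by positivity) (gumbelDensity_nonneg _ _)
  simp only [ENNReal.toReal_ofReal h, smul_eq_mul]
  ring

/-! ### The grid, its weights and the step function -/

/-- The value of `2 (log q) N + log (q - 1)` on the event `N = k`. -/
def gridPoint (q : ℝ) (k : ℕ) : ℝ := 2 * Real.log q * k + Real.log (q - 1)

/-- The index of the largest grid point that is at most `x`. -/
def gridIndex (q x : ℝ) : ℕ := ⌊(x - Real.log (q - 1)) / (2 * Real.log q)⌋₊

/-- The Euler mass at `k`, up to a factor that does not depend on `k`. -/
def gridWeight (q : ℝ) (k : ℕ) : ℝ :=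
  Real.exp (-gridPoint q k / 2) * tailProd (q ^ (-2 : ℤ)) k

/-- The step function whose integral is the sum of `f` over the weighted grid. -/
def stepFun (f : ℝ → ℝ) (q : ℝ) : ℝ → ℝ :=
  (Set.Ici (Real.log (q - 1))).indicator fun x =>
    f (gridPoint q (gridIndex q x)) * gridWeight q (gridIndex q x)

section

variable {q : ℝ} (hq : 1 < q)

include hq

theorem zpow_neg_two_pos : 0 < q ^ (-2 : ℤ) := zpow_pos (one_pos.trans hq) _

theorem zpow_neg_two_lt_one : q ^ (-2 : ℤ) < 1 := zpow_lt_one_of_neg₀ hq (by norm_num)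

theorem exp_neg_gridPoint (k : ℕ) :
    Real.exp (-gridPoint q k) = (q ^ (-2 : ℤ)) ^ k / (q - 1) := by
  have h0 : 0 < q := one_pos.trans hq
  have h : -gridPoint q k = k * (-2 * Real.log q) - Real.log (q - 1) := by
    unfold gridPoint
    ring
  rw [h, Real.exp_sub, Real.exp_log (by linarith), Real.exp_nat_mul]
  congr 2
  rw [show -2 * Real.log q = ((-2 : ℤ) : ℝ) * Real.log q by push_cast; ring,
    ← Real.log_zpow, Real.exp_log (zpow_pos h0 _)]

theorem exp_neg_gridPoint_half (k : ℕ) :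
    Real.exp (-gridPoint q k / 2) = q ^ (-(k : ℤ)) * Real.exp (-Real.log (q - 1) / 2) := by
  have h0 : 0 < q := one_pos.trans hq
  have h : -gridPoint q k / 2 = ((-(k : ℤ) : ℤ) : ℝ) * Real.log q + -Real.log (q - 1) / 2 := by
    unfold gridPoint
    push_cast
    ring
  rw [h, Real.exp_add, ← Real.log_zpow, Real.exp_log (zpow_pos h0 _)]

/-- This is where the shift log(q - 1) comes from: r/(1 - r) = 1/((q - 1)(q + 1)), and r^k/(q - 1) =
e^{-x_k}. -/
theorem zpow_div_eq (k : ℕ) :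
    (q ^ (-2 : ℤ)) ^ (k + 1) / (1 - q ^ (-2 : ℤ)) = Real.exp (-gridPoint q k) / (q + 1) := by
  have h0 : 0 < q := one_pos.trans hq
  have h1 : q - 1 ≠ 0 := by linarith
  have h2 : q + 1 ≠ 0 := by linarith
  have h3 : q ^ 2 - 1 ≠ 0 := by nlinarith
  rw [exp_neg_gridPoint hq, pow_succ]
  have h4 : q ^ (-2 : ℤ) / (1 - q ^ (-2 : ℤ)) = 1 / ((q - 1) * (q + 1)) := by
    have h5 : (q - 1) * (q + 1) = q ^ 2 - 1 := by ring
    rw [h5, zpow_neg, show q ^ (2 : ℤ) = q ^ 2 by norm_cast]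
    field_simp
  rw [mul_div_assoc, h4]
  field_simp

theorem gridWeight_pos (k : ℕ) : 0 < gridWeight q k :=
  mul_pos (Real.exp_pos _) (tailProd_pos (zpow_neg_two_pos hq) (zpow_neg_two_lt_one hq) k)

theorem gridWeight_le (k : ℕ) : gridWeight q k ≤ gumbelDensity (1 / (q + 1)) (gridPoint q k) := by
  have h := tailProd_le (zpow_neg_two_pos hq) (zpow_neg_two_lt_one hq) k
  rw [zpow_div_eq hq] at h
  refine mul_le_mul_of_nonneg_left (h.trans_eq ?_) (Real.exp_pos _).le
  congr 1
  ring

theorem le_gridWeight (k : ℕ) :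
    gumbelDensity (1 / (q + 1) / (1 - q ^ (-2 : ℤ) * (q - 1) * Real.exp (-gridPoint q k)))
      (gridPoint q k) ≤ gridWeight q k := by
  have h := le_tailProd (zpow_neg_two_pos hq) (zpow_neg_two_lt_one hq) k
  have h1 : q - 1 ≠ 0 := by linarith
  have h2 : (q ^ (-2 : ℤ)) ^ (k + 1) = q ^ (-2 : ℤ) * (q - 1) * Real.exp (-gridPoint q k) := by
    rw [exp_neg_gridPoint hq, pow_succ]
    field_simp
  rw [zpow_div_eq hq, h2] at h
  refine mul_le_mul_of_nonneg_left (Eq.trans_le ?_ h) (Real.exp_pos _).le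
  congr 1
  ring

theorem gridPoint_gridIndex_le {x : ℝ} (hx : Real.log (q - 1) ≤ x) :
    gridPoint q (gridIndex q x) ≤ x := by
  have hd : 0 < 2 * Real.log q := by linarith [Real.log_pos hq]
  have h := Nat.floor_le (div_nonneg (sub_nonneg.2 hx) hd.le)
  rw [le_div_iff₀ hd] at h
  unfold gridPoint gridIndex
  linarith

/-- Holds also to the left of the grid, where the natural-number floor is 0. -/
theorem lt_gridPoint_gridIndex_add (x : ℝ) :
    x < gridPoint q (gridIndex q x) + 2 * Real.log q := by
  have hd : 0 < 2 * Real.log q := by linarith [Real.log_pos hq]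
  have h := Nat.lt_floor_add_one ((x - Real.log (q - 1)) / (2 * Real.log q))
  rw [div_lt_iff₀ hd] at h
  unfold gridPoint gridIndex
  linarith

theorem gridIndex_eq {x : ℝ} {k : ℕ}
    (hx : x ∈ Set.Ico (gridPoint q k) (gridPoint q (k + 1))) : gridIndex q x = k := by
  have hd : 0 < 2 * Real.log q := by linarith [Real.log_pos hq]
  obtain ⟨h1, h2⟩ := hx
  unfold gridPoint at h1 h2
  push_cast at h2
  have h0 : (0 : ℝ) ≤ k := k.cast_nonneg
  rw [gridIndex, Nat.floor_eq_iff (by rw [le_div_iff₀ hd]; nlinarith), le_div_iff₀ hd,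
    div_lt_iff₀ hd]
  constructor <;> linarith

omit hq in
theorem gridPoint_succ (k : ℕ) : gridPoint q (k + 1) = gridPoint q k + 2 * Real.log q := by
  unfold gridPoint
  push_cast
  ring

theorem log_sub_one_le_gridPoint (k : ℕ) : Real.log (q - 1) ≤ gridPoint q k := by
  have := Real.log_pos hq
  have h : 0 ≤ 2 * Real.log q * k := by positivity
  unfold gridPoint
  linarith

theorem iUnion_Ico_gridPoint :
    ⋃ k, Set.Ico (gridPoint q k) (gridPoint q (k + 1)) = Set.Ici (Real.log (q - 1)) := by
  ext x
  simp only [Set.mem_iUnion, Set.mem_Ici]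
  constructor
  · rintro ⟨k, hk⟩
    exact (log_sub_one_le_gridPoint hq k).trans hk.1
  · intro hx
    refine ⟨gridIndex q x, gridPoint_gridIndex_le hq hx, ?_⟩
    rw [gridPoint_succ]
    exact lt_gridPoint_gridIndex_add hq x

/-- The dominating function, uniform over 1 < q ≤ 2. -/
theorem stepFun_abs_le {f : ℝ → ℝ} {C : ℝ} (hf : ∀ x, |f x| ≤ C) (hq2 : q ≤ 2) (x : ℝ) :
    ‖stepFun f q x‖ ≤ C * 2 * gumbelDensity (1 / 3) x := by
  have hC : 0 ≤ C := (abs_nonneg _).trans (hf 0)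
  have hq0 : 0 < q := one_pos.trans hq
  unfold stepFun
  by_cases hx : x ∈ Set.Ici (Real.log (q - 1))
  · rw [Set.indicator_of_mem hx, Real.norm_eq_abs, abs_mul, abs_of_pos (gridWeight_pos hq _),
      mul_assoc]
    refine mul_le_mul (hf _) ?_ (gridWeight_pos hq _).le hC
    refine (gridWeight_le hq _).trans ?_
    unfold gumbelDensity
    rw [← mul_assoc]
    have hle := gridPoint_gridIndex_le hq hx
    have hlt := lt_gridPoint_gridIndex_add hq x
    refine mul_le_mul ?_ ?_ (Real.exp_pos _).le (by positivity)
    -- Rounding x down by less than 2 log q costs at most a factor q ≤ 2.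
    · calc Real.exp (-gridPoint q (gridIndex q x) / 2)
          ≤ Real.exp (Real.log q + -x / 2) := Real.exp_le_exp.2 (by linarith)
        _ = q * Real.exp (-x / 2) := by rw [Real.exp_add, Real.exp_log hq0]
        _ ≤ 2 * Real.exp (-x / 2) := by gcongr
    -- Here rounding down helps, since it increases e^{-x}; the rate 1/3 comes from q + 1 ≤ 3.
    · refine Real.exp_le_exp.2 ?_
      rw [neg_mul, neg_mul, neg_le_neg_iff]
      refine mul_le_mul ?_ (Real.exp_le_exp.2 (by linarith)) (Real.exp_pos _).le (by positivity)
      exact one_div_le_one_div_of_le (by linarith) (by linarith)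
  · rw [Set.indicator_of_notMem hx, norm_zero]
    exact mul_nonneg (by linarith) (gumbelDensity_nonneg _ _)

omit hq in
theorem measurable_stepFun (f : ℝ → ℝ) (q : ℝ) : Measurable (stepFun f q) := by
  have hi : Measurable (gridIndex q) :=
    Nat.measurable_floor.comp ((measurable_id.sub_const _).div_const _)
  exact ((measurable_from_nat (f := fun k => f (gridPoint q k) * gridWeight q k)).comp hi).indicator
    measurableSet_Ici

theorem integrable_stepFun {f : ℝ → ℝ} {C : ℝ} (hf : ∀ x, |f x| ≤ C) (hq2 : q ≤ 2) :
    Integrable (stepFun f q) :=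
  ((integrable_gumbelDensity (c := 1 / 3) (by norm_num)).const_mul (C * 2)).mono'
    (measurable_stepFun f q).aestronglyMeasurable (ae_of_all _ (stepFun_abs_le hq hf hq2))

theorem integral_stepFun {f : ℝ → ℝ} {C : ℝ} (hf : ∀ x, |f x| ≤ C) (hq2 : q ≤ 2) :
    ∫ x, stepFun f q x
      = 2 * Real.log q * ∑' k, f (gridPoint q k) * gridWeight q k := by
  have hd : 0 < 2 * Real.log q := by linarith [Real.log_pos hq]
  have hdisj : Pairwise (Function.onFun Disjoint
      fun k => Set.Ico (gridPoint q k) (gridPoint q (k + 1))) := by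
    intro i j hij
    refine Set.disjoint_left.2 fun x hi hj => hij ?_
    rw [← gridIndex_eq hq hi, gridIndex_eq hq hj]
  have hpiece : ∀ k : ℕ, ∫ x in Set.Ico (gridPoint q k) (gridPoint q (k + 1)), stepFun f q x
      = 2 * Real.log q * (f (gridPoint q k) * gridWeight q k) := by
    intro k
    have hcongr : Set.EqOn (stepFun f q) (fun _ => f (gridPoint q k) * gridWeight q k)
        (Set.Ico (gridPoint q k) (gridPoint q (k + 1))) := by
      intro x hx
      have hx' : x ∈ Set.Ici (Real.log (q - 1)) := (log_sub_one_le_gridPoint hq k).trans hx.1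
      rw [stepFun, Set.indicator_of_mem hx', gridIndex_eq hq hx]
    rw [setIntegral_congr_fun measurableSet_Ico hcongr, setIntegral_const, gridPoint_succ,
      Real.volume_real_Ico_of_le (by linarith), add_sub_cancel_left, smul_eq_mul]
  have hsupp : ∫ x, stepFun f q x = ∫ x in Set.Ici (Real.log (q - 1)), stepFun f q x := by
    unfold stepFun
    rw [setIntegral_indicator measurableSet_Ici, Set.inter_self,
      integral_indicator measurableSet_Ici]
  rw [hsupp, ← iUnion_Ico_gridPoint hq,
    integral_iUnion (fun k => measurableSet_Ico) hdisj (integrable_stepFun hq hf hq2).integrableOn,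
    ← tsum_mul_left]
  exact tsum_congr hpiece

theorem eulerMass_eq (k : ℕ) :
    q ^ (-(k : ℤ)) / qPochhammer (q ^ (-2 : ℤ)) (q ^ (-2 : ℤ)) k
      = Real.exp (Real.log (q - 1) / 2) / qPochhammerInf (q ^ (-2 : ℤ)) * gridWeight q k := by
  have h1 := qPochhammerInf_pos (zpow_neg_two_pos hq) (zpow_neg_two_lt_one hq)
  have h2 : Real.exp (-Real.log (q - 1) / 2) = (Real.exp (Real.log (q - 1) / 2))⁻¹ := by
    rw [← Real.exp_neg, neg_div]
  rw [gridWeight, exp_neg_gridPoint_half hq, tailProd, h2]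
  have h3 := (Real.exp_pos (Real.log (q - 1) / 2)).ne'
  generalize Real.exp (Real.log (q - 1) / 2) = a at h3 ⊢
  generalize q ^ (-2 : ℤ) = r at h1 ⊢
  field_simp

end

/-! ### Expectations under the Euler law as ratios of integrals -/

theorem integral_eulerPMF (q : Set.Ioi (1 : ℝ)) (hq2 : (q : ℝ) ≤ 2) {f : ℝ → ℝ} {C : ℝ}
    (hf : ∀ x, |f x| ≤ C) :
    ∫ k, f (gridPoint q k) ∂(eulerPMF q).toMeasure
      = (∫ x, stepFun f q x) / ∫ x, stepFun (fun _ => 1) q x := by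
  have hq : (1 : ℝ) < q := q.2
  have hd : 2 * Real.log (q : ℝ) ≠ 0 := by linarith [Real.log_pos hq]
  have h0 := qPochhammerInf_pos (zpow_neg_two_pos hq) (zpow_neg_two_lt_one hq)
  have hint : Integrable (fun k => f (gridPoint q k)) (eulerPMF q).toMeasure :=
    Integrable.of_bound (measurable_from_nat).aestronglyMeasurable C
      (ae_of_all _ fun k => hf _)
  have hE : qExp ((q : ℝ) ^ (-2 : ℤ)) (q : ℝ)⁻¹
      = Real.exp (Real.log ((q : ℝ) - 1) / 2) / qPochhammerInf ((q : ℝ) ^ (-2 : ℤ))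
        * ∑' k, gridWeight q k := by
    rw [qExp, ← tsum_mul_left]
    refine tsum_congr fun k => ?_
    rw [← eulerMass_eq hq, inv_pow, zpow_neg (q : ℝ) k, zpow_natCast]
  have hEpos : 0 ≤ qExp ((q : ℝ) ^ (-2 : ℤ)) (q : ℝ)⁻¹ := by
    rw [hE]
    exact mul_nonneg (by positivity) (tsum_nonneg fun k => (gridWeight_pos hq k).le)
  have hmass : ∀ k, (eulerPMF q k).toReal = (qExp ((q : ℝ) ^ (-2 : ℤ)) (q : ℝ)⁻¹)⁻¹ *
      (Real.exp (Real.log ((q : ℝ) - 1) / 2) / qPochhammerInf ((q : ℝ) ^ (-2 : ℤ))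
        * gridWeight q k) := by
    intro k
    rw [← eulerMass_eq hq]
    refine ENNReal.toReal_ofReal (mul_nonneg (inv_nonneg.2 hEpos) ?_)
    rw [eulerMass_eq hq]
    exact mul_nonneg (by positivity) (gridWeight_pos hq k).le
  rw [PMF.integral_eq_tsum _ _ hint, integral_stepFun hq hf hq2,
    integral_stepFun hq (C := 1) (by simp) hq2, mul_div_mul_left _ _ hd, div_eq_inv_mul,
    ← tsum_mul_left]
  refine tsum_congr fun k => ?_
  rw [hmass, hE, smul_eq_mul]
  have h1 : Real.exp (Real.log ((q : ℝ) - 1) / 2) ≠ 0 := (Real.exp_pos _).ne'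
  simp only [one_mul]
  generalize (q : ℝ) ^ (-2 : ℤ) = r at h0 ⊢
  field_simp

/-! ### The limit as q decreases to 1 -/

/-- The filter of neighbourhoods of `1` from the right on the parameter space `(1, ∞)`. -/
abbrev rightOfOne : Filter (Set.Ioi (1 : ℝ)) :=
  comap (fun q : Set.Ioi (1 : ℝ) => (q : ℝ)) (𝓝[>] (1 : ℝ))

theorem tendsto_val_rightOfOne :
    Tendsto (fun q : Set.Ioi (1 : ℝ) => (q : ℝ)) rightOfOne (𝓝 1) :=
  tendsto_comap.mono_right nhdsWithin_le_nhds

theorem tendsto_log_sub_one_rightOfOne :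
    Tendsto (fun q : Set.Ioi (1 : ℝ) => Real.log ((q : ℝ) - 1)) rightOfOne atBot := by
  refine Real.tendsto_log_nhdsGT_zero.comp (tendsto_nhdsWithin_iff.2 ⟨?_, ?_⟩)
  · simpa using tendsto_val_rightOfOne.sub_const 1
  · exact Eventually.of_forall fun q => Set.mem_Ioi.2 (sub_pos.2 q.2)

theorem tendsto_gridPoint_gridIndex (x : ℝ) :
    Tendsto (fun q : Set.Ioi (1 : ℝ) => gridPoint q (gridIndex q x)) rightOfOne (𝓝 x) := by
  have hlog : Tendsto (fun q : Set.Ioi (1 : ℝ) => x - 2 * Real.log q) rightOfOne (𝓝 x) := by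
    have h := ((Real.continuousAt_log one_ne_zero).tendsto.comp tendsto_val_rightOfOne).const_mul 2
    simpa using h.const_sub x
  refine tendsto_of_tendsto_of_tendsto_of_le_of_le' hlog tendsto_const_nhds
    (Eventually.of_forall fun q => ?_) ?_
  · linarith [lt_gridPoint_gridIndex_add q.2 x]
  · filter_upwards [tendsto_log_sub_one_rightOfOne.eventually_le_atBot x] with q hq
    exact gridPoint_gridIndex_le q.2 hq

theorem tendsto_gumbelDensity {ι : Type*} {l : Filter ι} {c y : ι → ℝ} {c₀ y₀ : ℝ}
    (hc : Tendsto c l (𝓝 c₀)) (hy : Tendsto y l (𝓝 y₀)) :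
    Tendsto (fun i => gumbelDensity (c i) (y i)) l (𝓝 (gumbelDensity c₀ y₀)) :=
  ((Real.continuous_exp.tendsto _).comp (hy.neg.div_const 2)).mul
    ((Real.continuous_exp.tendsto _).comp
      (hc.neg.mul ((Real.continuous_exp.tendsto _).comp hy.neg)))

/-- Squeeze: both bounding rates tend to 1/2, because (q - 1) e^{-x_k} → 0 when x_k → x. -/
theorem tendsto_gridWeight (x : ℝ) :
    Tendsto (fun q : Set.Ioi (1 : ℝ) => gridWeight q (gridIndex q x)) rightOfOne
      (𝓝 (gumbelDensity (1 / 2) x)) := by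
  have hy := tendsto_gridPoint_gridIndex x
  have hv := tendsto_val_rightOfOne
  have hc : Tendsto (fun q : Set.Ioi (1 : ℝ) => 1 / ((q : ℝ) + 1)) rightOfOne (𝓝 (1 / 2)) := by
    have h := (tendsto_const_nhds (x := (1 : ℝ))).div (hv.add_const 1) (by norm_num)
    rwa [one_add_one_eq_two] at h
  have hz : Tendsto (fun q : Set.Ioi (1 : ℝ) => (q : ℝ) ^ (-2 : ℤ)) rightOfOne (𝓝 1) := by
    simpa using hv.zpow₀ (-2) (Or.inl one_ne_zero)
  have hc' : Tendsto (fun q : Set.Ioi (1 : ℝ) => 1 / ((q : ℝ) + 1) /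
      (1 - (q : ℝ) ^ (-2 : ℤ) * (q - 1) * Real.exp (-gridPoint q (gridIndex q x))))
      rightOfOne (𝓝 (1 / 2)) := by
    have h := ((hz.mul (hv.sub_const 1)).mul
      ((Real.continuous_exp.tendsto _).comp hy.neg)).const_sub 1
    have h2 := hc.div h (by simp)
    rwa [sub_self, mul_zero, zero_mul, sub_zero, div_one] at h2
  exact tendsto_of_tendsto_of_tendsto_of_le_of_le (tendsto_gumbelDensity hc' hy)
    (tendsto_gumbelDensity hc hy) (fun q => le_gridWeight q.2 _) (fun q => gridWeight_le q.2 _)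

theorem tendsto_stepFun {f : ℝ → ℝ} (hf : Continuous f) (x : ℝ) :
    Tendsto (fun q : Set.Ioi (1 : ℝ) => stepFun f q x) rightOfOne
      (𝓝 (f x * gumbelDensity (1 / 2) x)) := by
  refine (((hf.tendsto x).comp (tendsto_gridPoint_gridIndex x)).mul
    (tendsto_gridWeight x)).congr' ?_
  filter_upwards [tendsto_log_sub_one_rightOfOne.eventually_le_atBot x] with q hq
  rw [stepFun, Set.indicator_of_mem (Set.mem_Ici.2 hq)]
  rfl

theorem eventually_le_two_rightOfOne : ∀ᶠ q : Set.Ioi (1 : ℝ) in rightOfOne, (q : ℝ) ≤ 2 :=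
  tendsto_val_rightOfOne.eventually_le_const (by norm_num)

theorem tendsto_integral_stepFun {f : ℝ → ℝ} (hf : Continuous f) {C : ℝ}
    (hC : ∀ x, |f x| ≤ C) :
    Tendsto (fun q : Set.Ioi (1 : ℝ) => ∫ x, stepFun f q x) rightOfOne
      (𝓝 (∫ x, f x * gumbelDensity (1 / 2) x)) := by
  refine tendsto_integral_filter_of_dominated_convergence
    (fun x => C * 2 * gumbelDensity (1 / 3) x)
    (Eventually.of_forall fun q => (measurable_stepFun f q).aestronglyMeasurable) ?_
    ((integrable_gumbelDensity (by norm_num)).const_mul _)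
    (ae_of_all _ (tendsto_stepFun hf))
  filter_upwards [eventually_le_two_rightOfOne] with q hq
  exact ae_of_all _ (stepFun_abs_le q.2 hC hq)

theorem tendsto_integral_eulerPMF {f : ℝ → ℝ} (hf : Continuous f) {C : ℝ}
    (hC : ∀ x, |f x| ≤ C) :
    Tendsto (fun q : Set.Ioi (1 : ℝ) => ∫ k, f (gridPoint q k) ∂(eulerPMF q).toMeasure)
      rightOfOne (𝓝 (∫ x, f x ∂limitLaw)) := by
  have h1 := tendsto_integral_stepFun (continuous_const (y := (1 : ℝ))) (C := 1) (by simp)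
  simp only [one_mul, integral_gumbelDensity_half] at h1
  rw [integral_limitLaw]
  refine ((tendsto_integral_stepFun hf hC).div h1 (by positivity)).congr' ?_
  filter_upwards [eventually_le_two_rightOfOne] with q hq
  exact (integral_eulerPMF q hq hC).symm

end QPoisson

end

theorem proposition6p2 {Ω : Set.Ioi (1 : ℝ) → Type*} [∀ q, MeasurableSpace (Ω q)]
    (P : ∀ q, Measure (Ω q)) [∀ q, IsProbabilityMeasure (P q)]
    (N : ∀ q, Ω q → ℕ) (hN : ∀ q, HasLaw (N q) (QPoisson.eulerPMF q).toMeasure (P q)) :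
    ∃ _ : IsProbabilityMeasure QPoisson.limitLaw,
      TendstoInDistribution
        (fun (q : Set.Ioi (1 : ℝ)) (ω : Ω q) =>
          2 * Real.log (q : ℝ) * (N q ω : ℝ) + Real.log ((q : ℝ) - 1))
        (comap (fun q : Set.Ioi (1 : ℝ) => (q : ℝ)) (𝓝[>] (1 : ℝ)))
        (fun x : ℝ => x) P QPoisson.limitLaw := by
  have hX : ∀ q : Set.Ioi (1 : ℝ), AEMeasurable
      (fun ω => 2 * Real.log (q : ℝ) * (N q ω : ℝ) + Real.log ((q : ℝ) - 1)) (P q) := fun q =>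
    (measurable_from_nat (f := QPoisson.gridPoint q)).comp_aemeasurable (hN q).aemeasurable
  refine ⟨QPoisson.isProbabilityMeasure_limitLaw, hX, measurable_id.aemeasurable, ?_⟩
  -- Test against bounded continuous f, then transport each expectation to ℕ through the law of `N
  -- q`.
  refine ProbabilityMeasure.tendsto_iff_forall_integral_tendsto.2 fun f => ?_
  have h := QPoisson.tendsto_integral_eulerPMF f.continuous (C := ‖f‖) fun x => f.norm_coe_le_norm x
  simp only [ProbabilityMeasure.coe_mk, Measure.map_id']
  refine h.congr fun q => ?_
  rw [← (hN q).map_eq, integral_map (hN q).aemeasurable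
    measurable_from_nat.aestronglyMeasurable]
  exact (integral_map (hX q) f.continuous.aestronglyMeasurable).symm
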